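/- Let $\sigma = (\lambda_1,\lambda_2,\lambda_3,\lambda_4,\lambda_5)$ be a list of real numbers with elementary symmetric functions $e_n(\sigma)=\sum_{1\le j_1<\dots<j_n\le 5}\lambda_{j_1}\cdots\lambda_{j_n}$, and let $g\in\mathbb{R}$. Put $$r(\sigma)=e_3(\sigma)+e_1(\sigma)\left(\lambda_2^2+\lambda_5^2\right),$$ $$Q_\sigma(z)=2z^3-2(\lambda_3+\lambda_5)z^2-\left(e_2(\sigma)+(\lambda_3-\lambda_5)^2\right)z+e_3(\sigma)+e_1(\sigma)\left(\lambda_3^2+\lambda_5^2\right).$$ Assume that 1. $\lambda_1\ge\lambda_2\ge\lambda_3\ge\lambda_4\ge\lambda_5\ge-\lambda_1$, 2. $\sum_{j=1}^5\lambda_j\ge 0$, 3. $\lambda_3>e_1(\sigma)$, 4. $Q_\sigma(g)=0$ and $0\le g\le\frac12 e_1(\sigma)$, 5. $r(\sigma)<0$. For $s>0$ and $i\in\{2,3,4,5\}$ let $\sigma_i^{-s}$ be the list obtained from $\sigma$ by replacing $\lambda_1$ by $\lambda_1+s$ and $\lambda_i$ by $\lambda_i-s$. Then for every real $s>0$ and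 every $i\in\{2,3,4,5\}$ the list $\sigma_i^{-s}$ is the spectrum (eigenvalues counted with multiplicity) of a $5\times5$ symmetric entrywise nonnegative real matrix. -/

import Mathlib

open Polynomial

noncomputable section

/-- The `n`-th elementary symmetric function `e_n(σ)` of the entries of the list `σ`. -/
def listE (σ : Fin 5 → ℝ) (n : ℕ) : ℝ :=
  (Finset.univ.val.map σ).esymm n

/-- `r(σ) = e₃(σ) + e₁(σ) (λ₂² + λ₅²)`; the entry `λ_j` of the list is `σ (j - 1)`. -/
def listR (σ : Fin 5 → ℝ) : ℝ :=
  listE σ 3 + listE σ 1 * (σ 1 ^ 2 + σ 4 ^ 2)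

/-- The cubic polynomial
`Q_σ(z) = 2 z³ - 2 (λ₃ + λ₅) z² - (e₂ + (λ₃ - λ₅)²) z + e₃ + e₁ (λ₃² + λ₅²)`. -/
def polyQ (σ : Fin 5 → ℝ) : ℝ[X] :=
  C 2 * X ^ 3 - C (2 * (σ 2 + σ 4)) * X ^ 2 - C (listE σ 2 + (σ 2 - σ 4) ^ 2) * X
    + C (listE σ 3 + listE σ 1 * (σ 2 ^ 2 + σ 4 ^ 2))

/-- The list `σ_i^{-s}`: the first entry `λ₁` is replaced by `λ₁ + s` and the entry with index `i`
is lowered by `s` (for `i ≠ 0`). -/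
def guoMinus (σ : Fin 5 → ℝ) (i : Fin 5) (s : ℝ) : Fin 5 → ℝ :=
  Function.update (Function.update σ 0 (σ 0 + s)) i (σ i - s)

/-- `σ` is the spectrum, with multiplicities, of a `5 × 5` symmetric entrywise nonnegative
real matrix. -/
def SymNonnegRealizable (σ : Fin 5 → ℝ) : Prop :=
  ∃ A : Matrix (Fin 5) (Fin 5) ℝ, A.IsSymm ∧ (∀ p q, 0 ≤ A p q) ∧
    A.charpoly = ∏ j, (X - C (σ j))

end

/-! Write the list as p, a, b, -c, -d with sum t. A matrix commuting with a reflection splits into a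
2×2 block for b, -d and a 3×3 block for p, a, -c. Putting z, z and t - 2z on the diagonal, the
coefficient equations become solvable when Q(z) = 0; keeping all of t in one entry and using a free
off-diagonal entry instead, Q(0) ≥ 0 suffices. By the intermediate value theorem a single admissible
z with Q(z) ≥ 0 is then enough (`RealizesSpectrum.of_cubicQ_nonneg`).

Since Q(g) = 0, it remains to see that a perturbation leaves Q nonnegative at g, or at the lowered
middle entry when that lies in [0, g]. A nonpositive middle entry needs no cubic
(`RealizesSpectrum.of_nonpos`). -/

lemma listE_one (σ : Fin 5 → ℝ) : listE σ 1 = σ 0 + σ 1 + σ 2 + σ 3 + σ 4 := by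
  have h : (Finset.univ.val.map σ) = σ 0 ::ₘ σ 1 ::ₘ σ 2 ::ₘ σ 3 ::ₘ σ 4 ::ₘ 0 := rfl
  rw [listE, h]
  simp [Multiset.esymm, Multiset.powersetCard_one]
  ring

lemma listE_two (σ : Fin 5 → ℝ) :
    listE σ 2 = σ 0 * σ 1 + σ 0 * σ 2 + σ 0 * σ 3 + σ 0 * σ 4 + σ 1 * σ 2 + σ 1 * σ 3
      + σ 1 * σ 4 + σ 2 * σ 3 + σ 2 * σ 4 + σ 3 * σ 4 := by
  have h : (Finset.univ.val.map σ) = σ 0 ::ₘ σ 1 ::ₘ σ 2 ::ₘ σ 3 ::ₘ σ 4 ::ₘ 0 := rfl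
  rw [listE, h]
  simp [Multiset.esymm, Multiset.powersetCard_cons, Multiset.powersetCard_one]
  ring

lemma listE_three (σ : Fin 5 → ℝ) :
    listE σ 3 = σ 0 * σ 1 * σ 2 + σ 0 * σ 1 * σ 3 + σ 0 * σ 1 * σ 4 + σ 0 * σ 2 * σ 3
      + σ 0 * σ 2 * σ 4 + σ 0 * σ 3 * σ 4 + σ 1 * σ 2 * σ 3 + σ 1 * σ 2 * σ 4
      + σ 1 * σ 3 * σ 4 + σ 2 * σ 3 * σ 4 := by
  have h : (Finset.univ.val.map σ) = σ 0 ::ₘ σ 1 ::ₘ σ 2 ::ₘ σ 3 ::ₘ σ 4 ::ₘ 0 := rfl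
  rw [listE, h]
  simp [Multiset.esymm, Multiset.powersetCard_cons, Multiset.powersetCard_one]
  ring

/-- A symmetric matrix invariant under the simultaneous exchange of the indices `1 ↔ 2` and
`3 ↔ 4`. -/
def reflMatrix (τ α u y w x z : ℝ) : Matrix (Fin 5) (Fin 5) ℝ :=
  !![τ, w, w, 0, 0;
     w, α, u, x, z;
     w, u, α, z, x;
     0, x, z, 0, y;
     0, z, x, y, 0]

/-- The characteristic polynomial of `reflMatrix` is the product of those of its restrictions to
the antisymmetric and to the symmetric vectors. -/
lemma charpoly_reflMatrix (τ α u y w x z : ℝ) :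
    (reflMatrix τ α u y w x z).charpoly =
      ((X - C (α - u)) * (X + C y) - C ((x - z) ^ 2)) *
        ((X - C τ) * ((X - C (α + u)) * (X - C y) - C ((x + z) ^ 2))
          - C (2 * w ^ 2) * (X - C y)) := by
  rw [Matrix.charpoly]
  simp [reflMatrix, Matrix.charmatrix, Matrix.det_succ_row_zero, Fin.sum_univ_succ, Fin.succAbove,
    Matrix.diagonal_apply, show (C 2 : ℝ[X]) = 2 from map_ofNat C 2]
  ring

/-- The five numbers `p, a, b, -c, -d` are the spectrum of a symmetric nonnegative matrix. -/
def RealizesSpectrum (p a b c d : ℝ) : Prop :=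
  ∃ A : Matrix (Fin 5) (Fin 5) ℝ, A.IsSymm ∧ (∀ i j, 0 ≤ A i j) ∧
    A.charpoly = (X - C p) * (X - C a) * (X - C b) * (X + C c) * (X + C d)

/-- `reflMatrix` realizes `p, a, b, -c, -d` as soon as its antisymmetric part has the eigenvalues
`b, -d` and its symmetric part the eigenvalues `p, a, -c`, both expressed by coefficients. -/
lemma RealizesSpectrum.of_reflMatrix {p a b c d τ α u y w x z : ℝ}
    (hτ : 0 ≤ τ) (hα : 0 ≤ α) (hu : 0 ≤ u) (hy : 0 ≤ y) (hw : 0 ≤ w) (hx : 0 ≤ x) (hz : 0 ≤ z)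
    (h₁ : α - u - y = b - d) (h₂ : -(α - u) * y - (x - z) ^ 2 = -(b * d))
    (h₃ : τ + α + u + y = p + a - c)
    (h₄ : τ * (α + u + y) + (α + u) * y - (x + z) ^ 2 - 2 * w ^ 2 = p * a - (p + a) * c)
    (h₅ : τ * ((α + u) * y - (x + z) ^ 2) - 2 * w ^ 2 * y = -(p * a * c)) :
    RealizesSpectrum p a b c d := by
  refine ⟨reflMatrix τ α u y w x z, ?_, ?_, ?_⟩
  · ext i j
    fin_cases i <;> fin_cases j <;> rfl
  · intro i j
    fin_cases i <;> fin_cases j <;> simp [reflMatrix] <;> assumption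
  · have e₁ := congrArg (C : ℝ → ℝ[X]) h₁
    have e₂ := congrArg (C : ℝ → ℝ[X]) h₂
    have e₃ := congrArg (C : ℝ → ℝ[X]) h₃
    have e₄ := congrArg (C : ℝ → ℝ[X]) h₄
    have e₅ := congrArg (C : ℝ → ℝ[X]) h₅
    have anti : (X - C (α - u)) * (X + C y) - C ((x - z) ^ 2) = (X - C b) * (X + C d) := by
      simp only [map_sub, map_mul, map_pow, map_neg] at e₁ e₂ ⊢
      linear_combination (-X) * e₁ + e₂
    have symm : (X - C τ) * ((X - C (α + u)) * (X - C y) - C ((x + z) ^ 2))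
        - C (2 * w ^ 2) * (X - C y) = (X - C p) * (X - C a) * (X + C c) := by
      simp only [map_add, map_sub, map_mul, map_pow, map_neg] at e₃ e₄ e₅ ⊢
      linear_combination (-X ^ 2) * e₃ + X * e₄ - e₅
    rw [charpoly_reflMatrix, anti, symm]
    ring

/-- The value at `z` of the cubic `Q` of the list `p, a, b, -c, -d` of sum `t`, after `c` is
eliminated. -/
def cubicQ (t p a b d z : ℝ) : ℝ :=
  (p - d) * (p + a + b - t) * (d - a - b + z)
    - (b - z) * (2 * z ^ 2 + 2 * d * z + (a + b) * (a - t))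

/-- The antisymmetric block fixes y and x, the determinant of the symmetric block fixes W = 2w², and
its remaining coefficient equation, multiplied by y, is Q(z) = 0. -/
lemma RealizesSpectrum.of_cubicQ_eq_zero {t p a b c d z : ℝ} (ht : p + a + b - c - d = t)
    (hb : 0 ≤ b) (hbc : b < c) (hbd : b ≤ d) (ht0 : 0 ≤ t) (hta : t ≤ a) (hdp : d ≤ p)
    (hz : 0 ≤ z) (hzt : 2 * z ≤ t) (hzb : z ≤ b) (hzd : 0 < z - b + d)
    (hQ : cubicQ t p a b d z = 0) :
    RealizesSpectrum p a b c d := by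
  have hW : 0 ≤ ((t - 2 * z) * (2 * z * (z - b + d) - b * d) + p * a * c) / (z - b + d) := by
    refine div_nonneg ?_ hzd.le
    have h1 : t * (b * d) ≤ a * (c * p) :=
      mul_le_mul hta (mul_le_mul hbc.le hdp (by linarith) (by linarith))
        (mul_nonneg hb (by linarith)) (by linarith)
    have h2 : 0 ≤ z * (b * d) := by have : 0 ≤ d := by linarith
                                    positivity
    have h3 : 0 ≤ (t - 2 * z) * (2 * z * (z - b + d)) := by
      refine mul_nonneg (by linarith) (by positivity)
    nlinarith
  obtain ⟨W, hWdef⟩ : ∃ W, W = ((t - 2 * z) * (2 * z * (z - b + d) - b * d) + p * a * c)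
    / (z - b + d) := ⟨_, rfl⟩
  rw [← hWdef] at hW
  have hWy : W * (z - b + d) = (t - 2 * z) * (2 * z * (z - b + d) - b * d) + p * a * c := by
    rw [hWdef, div_mul_cancel₀ _ hzd.ne']
  have hx : 0 ≤ (b - z) * (z + d) := mul_nonneg (by linarith) (by linarith)
  obtain ⟨x, hx0, hxs⟩ : ∃ x : ℝ, 0 ≤ x ∧ x ^ 2 = (b - z) * (z + d) :=
    ⟨_, Real.sqrt_nonneg _, Real.sq_sqrt hx⟩
  have hws := Real.sq_sqrt (div_nonneg hW zero_le_two)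
  have hc : c = p + a + b - d - t := by linarith
  refine RealizesSpectrum.of_reflMatrix (τ := t - 2 * z) (α := z) (u := 0) (y := z - b + d)
    (w := √(W / 2)) (x := x) (z := 0) (by linarith) hz le_rfl hzd.le
    (Real.sqrt_nonneg _) hx0 le_rfl (by ring) ?_ (by linarith) ?_ ?_
  · rw [sub_zero, sub_zero, hxs]; ring
  · rw [add_zero, add_zero, hxs, hws]
    apply mul_right_cancel₀ hzd.ne'
    subst hc
    rw [cubicQ] at hQ
    linear_combination (-1) * hWy + hQ
  · rw [add_zero, add_zero, hxs, hws]
    linear_combination (-1) * hWy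

/-- With α = 0 the products u y cancel, so W = 2w² and then y are determined; the last entry
satisfies W u = Q(0). -/
lemma RealizesSpectrum.of_cubicQ_zero_nonneg {t p a b c d : ℝ} (ht : p + a + b - c - d = t)
    (hb : 0 ≤ b) (hbc : b < c) (hbd : b ≤ d) (ht0 : 0 ≤ t) (hta : t ≤ a) (hac : a ≤ c)
    (hcp : c ≤ p) (hdp : d ≤ p) (hQ : 0 ≤ cubicQ t p a b d 0) :
    RealizesSpectrum p a b c d := by
  obtain ⟨W, hW⟩ : ∃ W, W = t * (d - b) - b * d - p * a + (p + a) * c := ⟨_, rfl⟩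
  have hWpos : 0 < W := by
    have key : 0 < c ^ 2 + (p - c) * (c - a) - b * d + t * (d - b) := by
      have h1 : 0 < (c - b) * (c + t) := mul_pos (by linarith) (by linarith)
      have h2 : 0 ≤ (p - c) * (c - a) := mul_nonneg (by linarith) (by linarith)
      rcases le_total b t with h | h
      · have h3 : 0 ≤ (t - b) * d := mul_nonneg (by linarith) (by linarith)
        have h4 : 0 < c * (c - b) := mul_pos (by linarith) (by linarith)
        have h5 : 0 ≤ b * (c - t) := mul_nonneg hb (by linarith)
        nlinarith
      · rcases le_total c d with h' | h'
        · have h3 : 0 ≤ (d - c) * (p - d) := mul_nonneg (by linarith) (by linarith)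
          have h4 : 0 ≤ (p - d) * (c - a) := mul_nonneg (by linarith) (by linarith)
          have h5 : p = t - a - b + c + d := by linarith
          subst h5
          nlinarith
        · have h3 : 0 ≤ (b - t) * (c - d) := mul_nonneg (by linarith) (by linarith)
          nlinarith
    rw [hW]
    linarith
  obtain ⟨y, hy⟩ : ∃ y, y = (p * a * c - t * b * d) / W := ⟨_, rfl⟩
  have hyW : W * y = p * a * c - t * b * d := by rw [hy, mul_div_cancel₀ _ hWpos.ne']
  have hy0 : 0 ≤ y := by
    rw [hy]
    refine div_nonneg ?_ hWpos.le
    have h1 : t * (b * d) ≤ a * (c * p) :=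
      mul_le_mul hta (mul_le_mul hbc.le hdp (by linarith) (by linarith))
        (mul_nonneg hb (by linarith)) (by linarith)
    linarith
  have hu : 0 ≤ d - b - y := by
    refine nonneg_of_mul_nonneg_right (b := d - b - y) (a := W) ?_ hWpos
    have hc : c = p + a + b - d - t := by linarith
    have : W * (d - b - y) = cubicQ t p a b d 0 := by
      rw [mul_sub, hyW, hW, cubicQ]
      subst hc
      ring
    rwa [this]
  have hx : 0 ≤ b * d + (d - b - y) * y := by
    have : 0 ≤ d := by linarith
    positivity
  obtain ⟨x, hx0, hxs⟩ : ∃ x : ℝ, 0 ≤ x ∧ x ^ 2 = b * d + (d - b - y) * y :=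
    ⟨_, Real.sqrt_nonneg _, Real.sq_sqrt hx⟩
  have hws := Real.sq_sqrt (div_nonneg hWpos.le zero_le_two)
  refine RealizesSpectrum.of_reflMatrix (τ := t) (α := 0) (u := d - b - y) (y := y)
    (w := √(W / 2)) (x := x) (z := 0) ht0 le_rfl hu hy0
    (Real.sqrt_nonneg _) hx0 le_rfl (by ring) ?_ (by linarith) ?_ ?_
  · rw [sub_zero, hxs]; ring
  · rw [add_zero, hxs, hws]
    linear_combination -hW
  · rw [add_zero, hxs, hws]
    linear_combination -hyW

/-- A single point of `[0, min (t / 2) b]` at which the cubic is nonnegative suffices. -/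
lemma RealizesSpectrum.of_cubicQ_nonneg {t p a b c d z : ℝ} (ht : p + a + b - c - d = t)
    (hb : 0 ≤ b) (hbc : b < c) (hbd : b < d) (ht0 : 0 ≤ t) (hta : t ≤ a) (hac : a ≤ c)
    (hcp : c ≤ p) (hdp : d ≤ p) (hz : 0 ≤ z) (hzt : 2 * z ≤ t) (hzb : z ≤ b)
    (hQ : 0 ≤ cubicQ t p a b d z) :
    RealizesSpectrum p a b c d := by
  rcases le_total 0 (cubicQ t p a b d 0) with h0 | h0
  · exact .of_cubicQ_zero_nonneg ht hb hbc hbd.le ht0 hta hac hcp hdp h0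
  · have hcont : ContinuousOn (cubicQ t p a b d) (Set.Icc 0 z) := by
      unfold cubicQ
      fun_prop
    obtain ⟨y, ⟨hy0, hyz⟩, hy⟩ := intermediate_value_Icc hz hcont ⟨h0, hQ⟩
    exact .of_cubicQ_eq_zero ht hb hbc hbd.le ht0 hta hdp hy0 (by linarith) (by linarith)
      (by linarith) hy

/-- Taking x = z makes the antisymmetric block diagonal. Evaluating the symmetric block's
characteristic polynomial at t and at d gives 2w² and (x + z)². -/
lemma RealizesSpectrum.of_nonpos {t p a b c d : ℝ} (ht : p + a + b - c - d = t)
    (hb : b ≤ 0) (ht0 : 0 ≤ t) (hta : t ≤ a) (had : a ≤ d) (htd : t < d)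
    (hc : 0 ≤ c) (hdp : d ≤ p) :
    RealizesSpectrum p a b c d := by
  have htd' : 0 < d - t := by linarith
  have hP : 0 ≤ (p - t) * (a - t) * (t + c) / (d - t) :=
    div_nonneg (mul_nonneg (mul_nonneg (by linarith) (by linarith)) (by linarith)) htd'.le
  have hR : 0 ≤ (p - d) * (d - a) * (d + c) / (d - t) :=
    div_nonneg (mul_nonneg (mul_nonneg (by linarith) (by linarith)) (by linarith)) htd'.le
  have hws := Real.sq_sqrt (div_nonneg hP zero_le_two)
  have hxs := Real.sq_sqrt hR
  have hb' : b = t + c + d - p - a := by linarith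
  refine RealizesSpectrum.of_reflMatrix (τ := t) (α := 0) (u := -b) (y := d)
    (w := √((p - t) * (a - t) * (t + c) / (d - t) / 2))
    (x := √((p - d) * (d - a) * (d + c) / (d - t)) / 2)
    (z := √((p - d) * (d - a) * (d + c) / (d - t)) / 2) ht0 le_rfl (by linarith) (by linarith)
    (Real.sqrt_nonneg _) (by positivity) (by positivity) (by ring) (by ring) (by linarith) ?_ ?_
  · rw [add_halves, hxs, hws]
    subst hb'
    field_simp
    ring
  · rw [add_halves, hxs, hws]
    subst hb'
    field_simp
    ring

/-- At a root the two terms of Q balance and the subtracted one is positive, so the first has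
positive factors. The second bound compares d - a - b + g with d. -/
lemma le_mul_of_cubicQ_eq_zero {t p a b d g : ℝ} (hba : b ≤ a)
    (ht0 : 0 ≤ t) (htb : t < b) (had : a < d) (hdp : d ≤ p) (hg : 0 ≤ g) (hgt : 2 * g ≤ t)
    (hQ : cubicQ t p a b d g = 0) :
    0 < d - a - b + g ∧ 2 * g * (b - g) ≤ (p - d) * (p + a + b - t) := by
  rw [cubicQ] at hQ
  have hbg : 0 < b - g := by linarith
  have hK : 0 ≤ (p - d) * (p + a + b - t) := mul_nonneg (by linarith) (by linarith)
  have hS : 0 < (b - g) * ((a + b) * (a - t)) :=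
    mul_pos hbg (mul_pos (by linarith) (by linarith))
  have hbr : 0 ≤ (b - g) * (2 * g ^ 2) := mul_nonneg hbg.le (by positivity)
  have hd : 0 < d := by linarith
  have hbr' : 0 ≤ (b - g) * (2 * d * g) := mul_nonneg hbg.le (by positivity)
  have h1 : 0 < d - a - b + g := by
    by_contra! h
    have := mul_nonpos_of_nonneg_of_nonpos hK h
    nlinarith
  refine ⟨h1, ?_⟩
  refine le_of_mul_le_mul_right (a := d) ?_ hd
  have : (p - d) * (p + a + b - t) * (d - a - b + g) ≤ (p - d) * (p + a + b - t) * d :=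
    mul_le_mul_of_nonneg_left (by linarith) hK
  nlinarith

/-! ### Perturbing the spectrum -/

section Perturbation

variable {t p a b c d g s : ℝ}

lemma RealizesSpectrum.lower_last (ht : p + a + b - c - d = t) (hta : t ≤ a) (hba : b ≤ a)
    (ht0 : 0 ≤ t) (htb : t < b) (hac : a < c) (hcd : c ≤ d) (hdp : d ≤ p) (hg : 0 ≤ g)
    (hgt : 2 * g ≤ t) (hQ : cubicQ t p a b d g = 0) (hs : 0 < s) :
    RealizesSpectrum (p + s) a b c (d + s) := by
  obtain ⟨h1, h2⟩ := le_mul_of_cubicQ_eq_zero hba ht0 htb (by linarith) hdp hg hgt hQ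
  refine .of_cubicQ_nonneg (t := t) (z := g) (by linarith) (by linarith) (by linarith)
    (by linarith) ht0 hta hac.le (by linarith) (by linarith) hg hgt (by linarith) ?_
  -- The increase of Q(g) is exactly the sum of `h3` and `h4`.
  have h3 : 0 ≤ s * ((p - d) * (p + a + b - t) - 2 * g * (b - g)) :=
    mul_nonneg hs.le (by linarith)
  have h4 : 0 ≤ s * ((p - d) * (d - a - b + g + s)) :=
    mul_nonneg hs.le (mul_nonneg (by linarith) (by linarith))
  rw [cubicQ] at hQ ⊢
  linarith

lemma RealizesSpectrum.lower_fourth (ht : p + a + b - c - d = t) (hta : t ≤ a) (hba : b ≤ a)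
    (ht0 : 0 ≤ t) (htb : t < b) (hac : a < c) (hcd : c ≤ d) (hdp : d ≤ p) (hg : 0 ≤ g)
    (hgt : 2 * g ≤ t) (hQ : cubicQ t p a b d g = 0) (hs : 0 < s) :
    RealizesSpectrum (p + s) a b (c + s) d := by
  obtain ⟨h1, -⟩ := le_mul_of_cubicQ_eq_zero hba ht0 htb (by linarith) hdp hg hgt hQ
  refine .of_cubicQ_nonneg (t := t) (z := g) (by linarith) (by linarith) (by linarith)
    (by linarith) ht0 hta (by linarith) (by linarith) (by linarith) hg hgt (by linarith) ?_
  have h3 : 0 ≤ s * (p - d + (p + a + b - t) + s) * (d - a - b + g) :=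
    mul_nonneg (mul_nonneg hs.le (by linarith)) h1.le
  rw [cubicQ] at hQ ⊢
  linarith

/-- Comparison of two values of the cubic when the sum of the two middle entries drops by `s`. -/
lemma cubicQ_nonneg_of_cubicQ_eq_zero {a' b' : ℝ} (hS : a' + b' = a + b - s)
    (hK : 0 ≤ p + a + b - t) (hdp : d ≤ p) (hs : 0 ≤ s) (h1 : 0 ≤ d - a - b + g)
    (hb' : 0 ≤ b' - g) (hbb : b' ≤ b) (ha'b' : 0 ≤ a' + b') (hta' : t ≤ a') (haa : a' ≤ a)
    (hd : 0 ≤ d) (hg : 0 ≤ g) (hQ : cubicQ t p a b d g = 0) :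
    0 ≤ cubicQ t (p + s) a' b' d g := by
  have hfirst : (p - d) * (p + a + b - t) * (d - a - b + g)
      ≤ (p + s - d) * (p + a + b - t) * (d - a - b + g + s) :=
    mul_le_mul (mul_le_mul_of_nonneg_right (by linarith) hK) (by linarith) h1
      (mul_nonneg (by linarith) hK)
  have hsecond : (b' - g) * (2 * g ^ 2 + 2 * d * g + (a' + b') * (a' - t))
      ≤ (b - g) * (2 * g ^ 2 + 2 * d * g + (a + b) * (a - t)) := by
    have : (a' + b') * (a' - t) ≤ (a + b) * (a - t) :=
      mul_le_mul (by linarith) (by linarith) (by linarith) (by linarith)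
    have h' : 0 ≤ (a' + b') * (a' - t) := mul_nonneg ha'b' (by linarith)
    refine mul_le_mul (by linarith) (by linarith) (by positivity) (by linarith)
  have e1 : p + s + a' + b' - t = p + a + b - t := by linarith
  have e2 : d - a' - b' + g = d - a - b + g + s := by linarith
  rw [cubicQ] at hQ ⊢
  rw [e1, e2]
  linarith

/-- The middle entries `a, b` are replaced by smaller `a', b'` with `t ≤ a'`. -/
lemma RealizesSpectrum.lower_middle {a' b' : ℝ} (ht : p + a + b - c - d = t)
    (hba : b ≤ a) (ht0 : 0 ≤ t) (htb : t < b) (hac : a < c) (hcd : c ≤ d) (hdp : d ≤ p)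
    (hg : 0 ≤ g) (hgt : 2 * g ≤ t) (hQ : cubicQ t p a b d g = 0) (hs : 0 < s)
    (hS : a' + b' = a + b - s) (hta' : t ≤ a') (haa : a' ≤ a) (hbb : b' ≤ b) :
    RealizesSpectrum (p + s) a' b' c d := by
  obtain ⟨h1, -⟩ := le_mul_of_cubicQ_eq_zero hba ht0 htb (by linarith) hdp hg hgt hQ
  rcases le_total b' 0 with hb0 | hb0
  · exact .of_nonpos (t := t) (by linarith) hb0 ht0 hta' (by linarith) (by linarith)
      (by linarith) (by linarith)
  rcases le_total b' g with hbg | hbg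
  -- At z = b' the subtracted term of Q vanishes.
  · refine .of_cubicQ_nonneg (t := t) (z := b') (by linarith) hb0 (by linarith)
      (by linarith) ht0 hta' (by linarith) (by linarith) (by linarith) hb0 (by linarith) le_rfl ?_
    rw [cubicQ, sub_self, zero_mul, sub_zero]
    exact mul_nonneg (mul_nonneg (by linarith) (by linarith)) (by linarith)
  · refine .of_cubicQ_nonneg (t := t) (z := g) (by linarith) hb0 (by linarith)
      (by linarith) ht0 hta' (by linarith) (by linarith) (by linarith) hg hgt hbg ?_
    exact cubicQ_nonneg_of_cubicQ_eq_zero hS (by linarith) hdp hs.le h1.le (by linarith) hbb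
      (by linarith) hta' haa (by linarith) hg hQ

end Perturbation

theorem mainTheorem4 (σ : Fin 5 → ℝ) (g : ℝ)
    (hmono : Antitone σ) (hlast : -σ 0 ≤ σ 4)
    (htrace : 0 ≤ ∑ j, σ j)
    (hthird : listE σ 1 < σ 2)
    (hroot : (polyQ σ).IsRoot g)
    (hg0 : 0 ≤ g) (hg1 : g ≤ (1 / 2) * listE σ 1)
    (hr : listR σ < 0)
    (i : Fin 5) (hi : i ≠ 0) (s : ℝ) (hs : 0 < s) :
    SymNonnegRealizable (guoMinus σ i s) := by
  have h12 : σ 2 ≤ σ 1 := hmono (by decide)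
  have h34 : σ 4 ≤ σ 3 := hmono (by decide)
  rw [listE_one] at hthird hg1
  rw [Fin.sum_univ_five] at htrace
  have hQ : cubicQ (σ 0 + σ 1 + σ 2 + σ 3 + σ 4) (σ 0) (σ 1) (σ 2) (-σ 4) g = 0 := by
    have : (polyQ σ).eval g = 0 := hroot
    simp only [polyQ, eval_add, eval_sub, eval_mul, eval_C, eval_pow, eval_X, listE_one,
      listE_two, listE_three] at this
    rw [cubicQ]
    linear_combination this
  obtain ⟨t, ht⟩ : ∃ t, t = σ 0 + σ 1 + σ 2 + σ 3 + σ 4 := ⟨_, rfl⟩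
  rw [← ht] at hQ hg1 hthird htrace
  have hsum : σ 0 + σ 1 + σ 2 - (-σ 3) - (-σ 4) = t := by linarith
  have hta : t ≤ σ 1 := by linarith
  -- From t < λ₃ and λ₁ + λ₅ ≥ 0 follows λ₂ + λ₄ < 0.
  have hac : σ 1 < -σ 3 := by linarith
  have hcd : -σ 3 ≤ -σ 4 := by linarith
  have hdp : -σ 4 ≤ σ 0 := by linarith
  have hgt : 2 * g ≤ t := by linarith
  have middle := fun a' b' : ℝ => RealizesSpectrum.lower_middle (a' := a') (b' := b') hsum h12
    htrace hthird hac hcd hdp hg0 hgt hQ hs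
  fin_cases i
  · exact absurd rfl hi
  · rcases le_total t (σ 1 - s) with h | h
    · obtain ⟨A, hA, hA0, hch⟩ := middle (σ 1 - s) (σ 2) (by ring) h (by linarith) le_rfl
      refine ⟨A, hA, hA0, ?_⟩
      rw [hch]
      simp [guoMinus, Fin.prod_univ_five, Function.update_apply, ← sub_eq_add_neg]
    -- Once λ₂ - s is at most t, λ₃ takes over the role of a, which must stay at least t.
    · obtain ⟨A, hA, hA0, hch⟩ := middle (σ 2) (σ 1 - s) (by ring) hthird.le h12 (by linarith)
      refine ⟨A, hA, hA0, ?_⟩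
      rw [hch]
      simp [guoMinus, Fin.prod_univ_five, Function.update_apply]
      ring
  · obtain ⟨A, hA, hA0, hch⟩ := middle (σ 1) (σ 2 - s) (by ring) hta le_rfl (by linarith)
    refine ⟨A, hA, hA0, ?_⟩
    rw [hch]
    simp [guoMinus, Fin.prod_univ_five, Function.update_apply, ← sub_eq_add_neg]
  · obtain ⟨A, hA, hA0, hch⟩ := RealizesSpectrum.lower_fourth hsum hta h12 htrace hthird hac hcd
      hdp hg0 hgt hQ hs
    refine ⟨A, hA, hA0, ?_⟩
    rw [hch]
    simp [guoMinus, Fin.prod_univ_five, Function.update_apply]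
    ring
  · obtain ⟨A, hA, hA0, hch⟩ := RealizesSpectrum.lower_last hsum hta h12 htrace hthird hac hcd
      hdp hg0 hgt hQ hs
    refine ⟨A, hA, hA0, ?_⟩
    rw [hch]
    simp [guoMinus, Fin.prod_univ_five, Function.update_apply]
    ring
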